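/- All graphs are finite and simple, and paths have no repeated vertices. A graph $G$ is called $k$-connected ($k\ge 0$ an integer) if it has more than $k$ vertices and, for any two distinct vertices $u$ and $v$ of $G$, there is a set of $k$ pairwise internally disjoint $u$-$v$ paths. The length of a path is its number of edges, and a longest path of $G$ is a path of maximum length among all paths of $G$; $V(P)$ denotes the vertex set of a path $P$. **Theorem.** Let $G$ be a $k$-connected graph on $n$ vertices. Suppose that $G$ is not Hamiltonian (it has no Hamiltonian cycle, where the one-vertex graph counts as Hamiltonian), or that $4k+1\le 3n$ (equivalently, $(8k-n+2)/5\le n$). Let $P$ and $Q$ be two longest paths of $G$. Then $$|V(P)\cap V(Q)| \;\ge\; \frac{8k-n+2}{5}.$$ -/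

import Mathlib

namespace SimpleGraph

variable {V : Type*} {G : SimpleGraph V}

/-- Two `u`-`v` paths are internally disjoint if they have no internal vertex in common: every
vertex lying on both is one of the two extremes `u`, `v`. -/
def InternallyDisjointPaths {u v : V} (p q : G.Path u v) : Prop :=
  ∀ w : V, w ∈ p.val.support → w ∈ q.val.support → w = u ∨ w = v

/-- A graph is `k`-connected if it has more than `k` vertices and, for any two (distinct) vertices
`u` and `v`, there is a set of `k` pairwise internally disjoint `u`-`v` paths.
For graphs with at least two vertices the first condition follows from the second; it only
serves to keep the one-vertex graph from being `k`-connected for every `k`. -/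
def IsKConnected (G : SimpleGraph V) (k : ℕ) : Prop :=
  k < Nat.card V ∧
    ∀ u v : V, u ≠ v →
      ∃ S : Finset (G.Path u v), S.card = k ∧
        (S : Set (G.Path u v)).Pairwise InternallyDisjointPaths

/-- A longest path of `G`: a path whose length (number of edges) is maximum among all paths of
`G`, with arbitrary extremes. -/
def Walk.IsLongestPath {a b : V} (P : G.Walk a b) : Prop :=
  P.IsPath ∧ ∀ (c d : V) (R : G.Walk c d), R.IsPath → R.length ≤ P.length

end SimpleGraph

/-! Write `s` for the number of common vertices and `L` for the common number of vertices of the two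
paths; then `2 * L - s ≤ n`. Every neighbor of an end `c` of a longest path lies on that path. So
`k` internally disjoint paths from an outside vertex `v` to `c`, cut at their first vertex on the
path, form a fan with `k` distinct feet (`IsKConnected.exists_fan`). Maximality keeps the feet
apart: twice the total length of the fan is less than `L` (`sum_fan_le`). Hence `2 * k + 1 ≤ L`,
which settles `s ≥ k`. If `s < k`, Pósa rotations of `P` have at least `k` different ends, so one
end `v` is off `Q`. All neighbors of `v` lie on `P`, so at most `s` fan paths from `v` to `Q` are
single edges and the others have length at least 2. This gives `4 * k + 1 ≤ L + 2 * s`, and the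
result follows. If `Q` is spanning, then `s = n`, and either hypothesis suffices, the
non-Hamiltonian one by Dirac's crossing argument. -/

namespace SimpleGraph

open Finset

section LongestPaths

variable {V : Type*} {G : SimpleGraph V} {k : ℕ}

/-- The vertex sequence `l` of a path of `G` that has maximum length among all paths. -/
def IsLongestPathList (G : SimpleGraph V) (l : List V) : Prop :=
  l.IsChain G.Adj ∧ l.Nodup ∧
    ∀ l' : List V, l'.IsChain G.Adj → l'.Nodup → l'.length ≤ l.length

theorem Walk.IsLongestPath.isLongestPathList_support {a b : V} {P : G.Walk a b}
    (hP : P.IsLongestPath) : G.IsLongestPathList P.support := by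
  refine ⟨P.isChain_adj_support, hP.1.support_nodup, fun l hl hn => ?_⟩
  by_cases h : l = []
  · simp [h]
  · have h1 := hP.2 _ _ (Walk.ofSupport l h hl)
      ((Walk.isPath_def _).2 (by rwa [Walk.support_ofSupport]))
    rw [Walk.length_ofSupport] at h1
    rw [Walk.length_support]
    omega

theorem isChain_adj_reverse {l : List V} (h : l.IsChain G.Adj) : l.reverse.IsChain G.Adj := by
  rw [List.isChain_reverse]
  exact h.imp fun _ _ h => h.symm

theorem IsLongestPathList.reverse {l : List V} (h : G.IsLongestPathList l) :
    G.IsLongestPathList l.reverse :=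
  ⟨isChain_adj_reverse h.1, List.nodup_reverse.2 h.2.1, by simpa using h.2.2⟩

theorem IsLongestPathList.mem_of_adj_head {c x : V} {l : List V}
    (h : G.IsLongestPathList (c :: l)) (hx : G.Adj c x) : x ∈ c :: l := by
  by_contra hn
  have := h.2.2 (x :: c :: l) (List.isChain_cons_cons.2 ⟨hx.symm, h.1⟩)
    (List.nodup_cons.2 ⟨hn, h.2.1⟩)
  simp at this

/-! ### Fans from a vertex to a path -/

/-- Splitting a list at its first element in a set. -/
theorem exists_eq_append_cons_first {X : Set V} :
    ∀ {l : List V} {x : V}, x ∈ l → x ∈ X →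
      ∃ B w R, l = B ++ w :: R ∧ (∀ y ∈ B, y ∉ X) ∧ w ∈ X
  | [], _, h, _ => by simp at h
  | a :: l, x, h, hx => by
    by_cases ha : a ∈ X
    · exact ⟨[], a, l, rfl, by simp, ha⟩
    · have hxl : x ∈ l := by
        rcases List.mem_cons.1 h with rfl | h
        · exact absurd hx ha
        · exact h
      obtain ⟨B, w, R, rfl, hB, hw⟩ := exists_eq_append_cons_first hxl hx
      exact ⟨a :: B, w, R, rfl, by simpa [ha] using hB, hw⟩

/-- If all neighbors of `c` are in `X`, then a path from outside `X` to `c` enters `X` at a vertex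
other than `c`. -/
theorem Walk.IsPath.exists_first_mem {X : Set V} {v c : V} {p : G.Walk v c} (hp : p.IsPath)
    (hv : v ∉ X) (hc : c ∈ X) (hN : ∀ x, G.Adj c x → x ∈ X) :
    ∃ C w, (v :: C ++ [w]).IsChain G.Adj ∧ (v :: C).Nodup ∧ (∀ x ∈ v :: C, x ∉ X) ∧
      (∀ x ∈ C, x ≠ v) ∧ w ∈ X ∧ w ≠ c ∧ (∀ x ∈ C, x ∈ p.support) ∧ w ∈ p.support := by
  obtain ⟨B, w, R, hl, hB, hw⟩ := exists_eq_append_cons_first p.end_mem_support hc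
  have hch := p.isChain_adj_support
  have hnd := hp.support_nodup
  cases B with
  | nil =>
    have := p.cons_tail_support
    rw [hl] at this
    simp only [List.nil_append, List.tail_cons, List.cons.injEq] at this
    exact absurd (this.1 ▸ hw) hv
  | cons v' C =>
    have h1 := p.cons_tail_support
    rw [hl] at h1
    simp only [List.cons_append, List.tail_cons, List.cons.injEq, and_true] at h1
    subst h1
    rw [hl] at hch hnd
    have hch' : ((v :: C) ++ [w]).IsChain G.Adj := (List.isChain_split.1 hch).1
    refine ⟨C, w, hch', (List.nodup_append.1 hnd).1, hB, ?_, hw, ?_, ?_, by simp [hl]⟩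
    · rintro x hx rfl
      exact (List.nodup_cons.1 (List.nodup_append.1 hnd).1).1 hx
    · rintro rfl
      -- Were `c` the first vertex met in `X`, its predecessor would be a neighbor of `c` outside
      -- `X`.
      have hlast := hB ((v :: C).getLast (by simp)) (List.getLast_mem _)
      refine hlast (hN _ ?_)
      rw [List.isChain_append] at hch'
      exact (hch'.2.2 _ (List.getLast_mem_getLast? (by simp)) w (by simp)).symm
    · intro x hx
      simp [hl, hx]

/-- A fan of `k` paths from `v` to `X`, obtained from internally disjoint paths from `v` to a
vertex all of whose neighbors are in `X`. -/
theorem IsKConnected.exists_fan (hG : G.IsKConnected k) {X : Set V} {v c : V}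
    (hv : v ∉ X) (hc : c ∈ X) (hN : ∀ x, G.Adj c x → x ∈ X) :
    ∃ (C : Fin k → List V) (w : Fin k → V),
      (∀ i, (v :: C i ++ [w i]).IsChain G.Adj ∧ (v :: C i).Nodup ∧ (∀ x ∈ v :: C i, x ∉ X) ∧
        w i ∈ X) ∧
      ∀ i j, i ≠ j → (C i).Disjoint (C j) ∧ w i ≠ w j := by
  have hvc : v ≠ c := by rintro rfl; exact hv hc
  obtain ⟨S, hS, hd⟩ := hG.2 v c hvc
  choose C w h1 h2 h3 h4 h5 h6 h7 h8 using
    fun p : G.Path v c => p.2.exists_first_mem hv hc hN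
  let e := (S.equivFinOfCardEq hS).symm
  refine ⟨fun i => C (e i), fun i => w (e i), fun i => ⟨h1 _, h2 _, h3 _, h5 _⟩, fun i j hij => ?_⟩
  have hne : (e i : G.Path v c) ≠ e j := fun h => hij (e.injective (Subtype.ext h))
  have hdis := hd (e i).2 (e j).2 hne
  constructor
  · intro x hx hx'
    rcases hdis x (h7 _ x hx) (h7 _ x hx') with rfl | rfl
    · exact h4 _ _ hx rfl
    · exact h3 _ x (List.mem_cons_of_mem _ hx) hc
  · intro h
    have h : w (e i) = w (e j) := h
    rcases hdis (w (e i)) (h8 _) (h.symm ▸ h8 _) with h' | h'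
    · exact hv (h' ▸ h5 _)
    · exact h6 _ h'

/-- The second vertices of `k` disjoint paths from `v` to some `u` are distinct neighbors of `v`:
two could only coincide at `u`, and then both paths are the edge `vu`. -/
theorem IsKConnected.le_card_of_neighbors [DecidableEq V] [Fintype V] (hG : G.IsKConnected k)
    {v : V} {N : Finset V} (hN : ∀ x, G.Adj v x → x ∈ N) : k ≤ #N := by
  have hk := hG.1
  rw [Nat.card_eq_fintype_card] at hk
  by_cases h : ∃ u, u ≠ v
  · obtain ⟨u, hu⟩ := h
    obtain ⟨S, hS, hd⟩ := hG.2 v u hu.symm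
    rw [← hS]
    have hnil : ∀ p : G.Path v u, ¬ p.1.Nil := fun p hp => hu hp.eq.symm
    refine card_le_card_of_injOn (fun p => p.1.snd) (fun p _ => hN _ (p.1.adj_snd (hnil p))) ?_
    intro p hp q hq hpq
    by_contra hne
    simp only at hpq
    have h1 := hd hp hq hne p.1.snd (p.1.getVert_mem_support 1)
      (hpq ▸ q.1.getVert_mem_support 1)
    rcases h1 with h1 | h1
    · exact (p.1.adj_snd (hnil p)).ne h1.symm
    · have key : ∀ r : G.Path v u, r.1.snd = u → r.1.length = 1 := by
        intro r hr
        have h0 : r.1.length ≠ 0 := fun h => hnil r (Walk.length_eq_zero_iff.1 h)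
        have := r.2.getVert_injOn (x₁ := 1) (x₂ := r.1.length)
          (by simp only [Set.mem_ofPred_eq]; omega) (by simp)
          (by rw [Walk.getVert_length]; exact hr)
        omega
      have e1 := key p h1
      have e2 := key q (hpq ▸ h1)
      apply hne
      apply Subtype.ext
      obtain ⟨p, hp'⟩ := p
      obtain ⟨q, hq'⟩ := q
      cases p with
      | nil => simp at e1
      | cons h p =>
        cases q with
        | nil => simp at e2
        | cons h' q =>
          cases p with
          | nil =>
            cases q with
            | nil => rfl
            | cons _ _ => simp at e2
          | cons _ _ => simp at e1
  · push Not at h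
    have : Fintype.card V ≤ 1 := Fintype.card_le_one_iff.2 fun a b => (h a).trans (h b).symm
    omega

/-! ### Length of a fan to a longest path -/

/-- The part of a longest path on one side of the foot of a path leaving it is at least as long as
the leaving path. -/
theorem IsLongestPathList.length_le_drop {l C : List V} (hl : G.IsLongestPathList l) {v : V}
    {j : ℕ} (hj : j < l.length) (hch : (v :: C ++ [l[j]]).IsChain G.Adj) (hnd : (v :: C).Nodup)
    (hdis : ∀ x ∈ v :: C, x ∉ l) : C.length + 1 ≤ j := by
  have h := hl.2.2 (v :: C ++ l.drop j) ?_ ?_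
  · simp at h
    omega
  · rw [← List.cons_getElem_drop_succ (h := hj), List.isChain_split]
    refine ⟨hch, ?_⟩
    rw [List.cons_getElem_drop_succ]
    exact hl.1.drop j
  · refine List.nodup_append.2 ⟨hnd, hl.2.1.sublist (List.drop_sublist _ _), ?_⟩
    rintro x hx y hy rfl
    exact hdis x hx (List.mem_of_mem_drop hy)

theorem IsLongestPathList.length_le_take {l C : List V} (hl : G.IsLongestPathList l) {v : V}
    {j : ℕ} (hj : j < l.length) (hch : (v :: C ++ [l[j]]).IsChain G.Adj) (hnd : (v :: C).Nodup)
    (hdis : ∀ x ∈ v :: C, x ∉ l) : j + (C.length + 1) + 1 ≤ l.length := by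
  have h := hl.reverse.length_le_drop (j := l.length - 1 - j) (v := v) (C := C) (by simp; omega)
    ?_ hnd (by simpa using hdis)
  · omega
  · rw [List.getElem_reverse]
    have : l.length - 1 - (l.length - 1 - j) = j := by omega
    simpa only [this] using hch

/-- The detour through `C` reversed, `v` and `D` may replace the vertices strictly between positions
`i` and `j`, so it cannot have more vertices than they do. -/
theorem IsLongestPathList.length_add_length_le {l C D : List V} (hl : G.IsLongestPathList l)
    {v : V} {i j : ℕ} (hij : i < j) (hj : j < l.length)
    (hC : (v :: C ++ [l[i]]).IsChain G.Adj) (hD : (v :: D ++ [l[j]]).IsChain G.Adj)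
    (hCn : (v :: C).Nodup) (hDn : (v :: D).Nodup) (hCl : ∀ x ∈ v :: C, x ∉ l)
    (hDl : ∀ x ∈ v :: D, x ∉ l) (hdis : C.Disjoint D) :
    i + (C.length + 1) + (D.length + 1) ≤ j := by
  have h := hl.2.2 ((l.take (i + 1) ++ C.reverse) ++ (v :: (D ++ l.drop j))) ?_ ?_
  · simp at h
    omega
  · rw [List.isChain_split]
    constructor
    · have e : l.take (i + 1) ++ C.reverse ++ [v] = l.take i ++ l[i] :: (C.reverse ++ [v]) := by
        rw [← List.take_concat_get' _ _ (hij.trans hj)]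
        simp only [List.append_assoc, List.nil_append, List.cons_append]
      rw [e, List.isChain_split]
      constructor
      · rw [List.take_concat_get' _ _ (hij.trans hj)]
        exact hl.1.take _
      · have := isChain_adj_reverse hC
        simpa using this
    · rw [← List.cons_append, ← List.cons_getElem_drop_succ (h := hj), List.isChain_split]
      refine ⟨hD, ?_⟩
      rw [List.cons_getElem_drop_succ]
      exact hl.1.drop j
  · have htd : ∀ x, x ∈ l.take (i + 1) → x ∈ l.drop j → False := fun x h1 h2 =>
      List.disjoint_take_drop hl.2.1 hij h1 h2
    have h1 : (l.take (i + 1)).Nodup := hl.2.1.sublist (List.take_sublist _ _)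
    have h2 : (l.drop j).Nodup := hl.2.1.sublist (List.drop_sublist _ _)
    have h3 : ∀ x ∈ l.take (i + 1), x ∈ l := fun x => List.mem_of_mem_take
    have h4 : ∀ x ∈ l.drop j, x ∈ l := fun x => List.mem_of_mem_drop
    simp only [List.nodup_append, List.nodup_cons, List.mem_append, List.mem_reverse,
      List.nodup_reverse, List.mem_cons] at *
    refine ⟨⟨h1, hCn.2, ?_⟩, ⟨?_, hDn.2, h2, ?_⟩, ?_⟩
    · rintro x hx y hy rfl
      exact hCl x (Or.inr hy) (h3 x hx)
    · rintro (h | h)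
      · exact hDn.1 h
      · exact hDl v (Or.inl rfl) (h4 v h)
    · rintro x hx y hy rfl
      exact hDl x (Or.inr hx) (h4 x hy)
    · rintro x hx y hy rfl
      rcases hx with hx | hx <;> rcases hy with rfl | hy | hy
      · exact hDl x (Or.inl rfl) (h3 x hx)
      · exact hDl x (Or.inr hy) (h3 x hx)
      · exact htd x hx hy
      · exact hCn.1 hx
      · exact hdis hx hy
      · exact hCl x (Or.inr hx) (h4 x hy)

/-- Twice the total length of a fan to a longest path is at most the length of the path. -/
theorem IsLongestPathList.sum_fan_le {l : List V} (hl : G.IsLongestPathList l) (hne : l ≠ [])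
    {v : V} {C : Fin k → List V} {w : Fin k → V}
    (hC : ∀ i, (v :: C i ++ [w i]).IsChain G.Adj ∧ (v :: C i).Nodup ∧ (∀ x ∈ v :: C i, x ∉ l) ∧
      w i ∈ l)
    (hd : ∀ i j, i ≠ j → (C i).Disjoint (C j) ∧ w i ≠ w j) :
    ∑ i, 2 * ((C i).length + 1) + 1 ≤ l.length := by
  have hw : ∀ i, ∃ n, ∃ h : n < l.length, l[n] = w i := fun i => List.getElem_of_mem (hC i).2.2.2
  choose n hn hnw using hw
  have hlow : ∀ i, (C i).length + 1 ≤ n i := fun i =>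
    hl.length_le_drop (hn i) (by rw [hnw]; exact (hC i).1) (hC i).2.1 (hC i).2.2.1
  have hup : ∀ i, n i + ((C i).length + 1) + 1 ≤ l.length := fun i =>
    hl.length_le_take (hn i) (by rw [hnw]; exact (hC i).1) (hC i).2.1 (hC i).2.2.1
  have hpair : ∀ i j, i ≠ j → n i < n j →
      n i + ((C i).length + 1) + ((C j).length + 1) ≤ n j := fun i j hij h =>
    hl.length_add_length_le h (hn j) (by rw [hnw]; exact (hC i).1) (by rw [hnw]; exact (hC j).1)
      (hC i).2.1 (hC j).2.1 (hC i).2.2.1 (hC j).2.2.1 (hd i j hij).1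
  -- Number the edges of the path by their left ends: `I i` is the set of edges within distance `(C
  -- i).length + 1` of the foot, and there are `l.length - 1` edges in all.
  let I : Fin k → Finset ℕ := fun i =>
    Finset.Ico (n i - ((C i).length + 1)) (n i + ((C i).length + 1))
  have hI : ∀ i, #(I i) = 2 * ((C i).length + 1) := fun i => by
    have := hlow i
    simp only [I, Nat.card_Ico]
    omega
  have hdisj : ∀ i ∈ univ, ∀ j ∈ univ, i ≠ j → Disjoint (I i) (I j) := by
    intro i _ j _ hij
    rw [Finset.disjoint_left]
    intro x hx hx'
    simp only [I, Finset.mem_Ico] at hx hx'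
    rcases lt_trichotomy (n i) (n j) with h | h | h
    · have := hpair i j hij h
      omega
    · refine (hd i j hij).2 ?_
      rw [← hnw i, ← hnw j]
      simp only [h]
    · have := hpair j i hij.symm h
      omega
  have hpos := List.length_pos_of_ne_nil hne
  have hsub : univ.biUnion I ⊆ Finset.range (l.length - 1) := by
    intro x hx
    obtain ⟨i, -, hi⟩ := Finset.mem_biUnion.1 hx
    have := hup i
    simp only [I, Finset.mem_Ico] at hi
    rw [Finset.mem_range]
    omega
  have h := card_le_card hsub
  rw [card_biUnion hdisj, card_range] at h
  simp only [hI] at h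
  omega

theorem IsKConnected.length_bounds [DecidableEq V] (hG : G.IsKConnected k) {l : List V}
    (hl : G.IsLongestPathList l) {v : V} (hv : v ∉ l) {N : Finset V}
    (hN : ∀ x ∈ l, G.Adj v x → x ∈ N) :
    2 * k + 1 ≤ l.length ∧ 4 * k + 1 ≤ l.length + 2 * #N := by
  cases l with
  | nil => simpa using hl.2.2 [v] (by simp) (by simp)
  | cons c l =>
    obtain ⟨C, w, hC, hd⟩ := hG.exists_fan (X := {x | x ∈ c :: l}) hv
      (by simp : c ∈ {x | x ∈ c :: l}) (fun x hx => hl.mem_of_adj_head hx)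
    have hsum := hl.sum_fan_le (by simp) hC hd
    rw [← Finset.mul_sum, Finset.sum_add_distrib] at hsum
    simp only [sum_const, card_univ, Fintype.card_fin, smul_eq_mul, mul_one] at hsum
    refine ⟨by omega, ?_⟩
    -- A fan path with `C i = []` is a single edge, so its foot is a neighbor of `v` on `l`.
    have h1 : #{i | (C i).length = 0} ≤ #N := by
      refine card_le_card_of_injOn w (fun i hi => ?_) (fun i _ j _ hij => ?_)
      · have hi' : C i = [] := by simpa using hi
        have := (hC i).1
        rw [hi'] at this
        exact hN _ (hC i).2.2.2 (by simpa using this)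
      · by_contra h
        exact (hd i j h).2 hij
    have h2 : k ≤ #{i | (C i).length = 0} + ∑ i, (C i).length := by
      rw [Finset.card_filter, ← Finset.sum_add_distrib]
      calc k = ∑ _i : Fin k, 1 := by simp
        _ ≤ _ := Finset.sum_le_sum fun i _ => by split_ifs <;> omega
    omega

/-! ### Rotations and the intersection of two longest paths -/

/-- The ends of rotations of a path. -/
theorem IsKConnected.le_card_rotations [Fintype V] [DecidableEq V] [DecidableRel G.Adj]
    (hG : G.IsKConnected k) {a : V} {l : List V} (hl : G.IsLongestPathList (a :: l)) :
    k ≤ #{i : Fin l.length | G.Adj a l[i]} := by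
  refine (hG.le_card_of_neighbors (v := a)
    (N := Finset.image (fun i : Fin l.length => l[i]) {i | G.Adj a l[i]}) ?_).trans card_image_le
  intro x hx
  rcases List.mem_cons.1 (hl.mem_of_adj_head hx) with rfl | h
  · exact absurd hx G.irrefl
  · obtain ⟨i, hi, rfl⟩ := List.getElem_of_mem h
    exact Finset.mem_image.2 ⟨⟨i, hi⟩, by simpa using hx, rfl⟩

/-- Pósa rotation. -/
theorem IsLongestPathList.rotation {a : V} {l : List V} (hl : G.IsLongestPathList (a :: l))
    {i : ℕ} (hi : i < l.length) (ha : G.Adj a l[i]) :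
    G.IsLongestPathList (((a :: l).take (i + 1)).reverse ++ l.drop i) := by
  have hperm : (((a :: l).take (i + 1)).reverse ++ l.drop i).Perm (a :: l) := by
    have e : l.drop i = (a :: l).drop (i + 1) := by simp
    rw [e]
    refine ((List.reverse_perm _).append_right _).trans ?_
    rw [List.take_append_drop]
  refine ⟨?_, hperm.nodup_iff.2 hl.2.1, fun l' h1 h2 => hperm.length_eq ▸ hl.2.2 l' h1 h2⟩
  rw [List.isChain_append]
  refine ⟨isChain_adj_reverse (hl.1.take _), ?_, ?_⟩
  · have := hl.1.drop (i + 1)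
    simpa using this
  · intro x hx y hy
    rw [List.getLast?_reverse] at hx
    simp only [List.take_succ_cons, List.head?_cons, Option.mem_def, Option.some.injEq] at hx
    rw [List.head?_drop, List.getElem?_eq_getElem hi] at hy
    simp only [Option.mem_def, Option.some.injEq] at hy
    rw [← hx, ← hy]
    exact ha

theorem IsKConnected.length_bound_of_inter [Fintype V] [DecidableEq V] (hG : G.IsKConnected k)
    {l m : List V} (hl : G.IsLongestPathList l) (hm : G.IsLongestPathList m) (hne : l ≠ [])
    (hk : #(l.toFinset ∩ m.toFinset) < k) :
    4 * k + 1 ≤ m.length + 2 * #(l.toFinset ∩ m.toFinset) := by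
  classical
  cases l with
  | nil => exact absurd rfl hne
  | cons a l =>
    have hrot := hG.le_card_rotations hl
    -- Each neighbor `l[i]` of `a` yields a rotation ending at its predecessor `(a :: l)[i]`. These
    -- at least `k` predecessors cannot all be among the fewer than `k` common vertices.
    obtain ⟨i, hi, him⟩ : ∃ i : Fin l.length, G.Adj a l[i] ∧
        (a :: l)[(i : ℕ)]'(by simp) ∉ m := by
      by_contra! h
      refine (hk.trans_le hrot).not_ge ?_
      refine card_le_card_of_injOn (fun i : Fin l.length => (a :: l)[(i : ℕ)]'(by simp))
        (fun i hi => ?_) (fun i _ j _ hij => ?_)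
      · have := h i (by simpa using hi)
        simp only [coe_inter, Set.mem_inter_iff, mem_coe, List.mem_toFinset]
        exact ⟨List.getElem_mem _, this⟩
      · exact Fin.ext ((List.Nodup.getElem_inj_iff hl.2.1).1 hij)
    have hr := hl.rotation i.2 hi
    have hmem : ∀ x, x ∈ ((a :: l).take (i + 1)).reverse ++ l.drop i → x ∈ a :: l := by
      intro x hx
      rcases List.mem_append.1 hx with h | h
      · exact List.mem_of_mem_take (List.mem_reverse.1 h)
      · exact List.mem_cons_of_mem _ (List.mem_of_mem_drop h)
    have hhead : ((a :: l).take (i + 1)).reverse ++ l.drop i =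
        (a :: l)[(i : ℕ)]'(by simp) ::
          (((a :: l).take i).reverse ++ l.drop i) := by
      rw [← List.take_concat_get' _ _ (by simp), List.reverse_append]
      simp only [List.reverse_singleton, List.nil_append, List.cons_append]
    refine (hG.length_bounds hm him (fun x hx hadj => ?_)).2
    rw [hhead] at hr hmem
    exact Finset.mem_inter.2 ⟨List.mem_toFinset.2 (hmem x (hr.mem_of_adj_head hadj)),
      List.mem_toFinset.2 hx⟩

/-! ### The spanning case -/

/-- A spanning path whose ends are adjacent closes up to a Hamiltonian cycle. -/
theorem isHamiltonian_of_list [Fintype V] [DecidableEq V] {l : List V} (hch : l.IsChain G.Adj)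
    (hnd : l.Nodup) (hcard : l.length = Fintype.card V) (h3 : 3 ≤ l.length)
    (hadj : G.Adj (l.getLast (by rintro rfl; simp at h3)) (l.head (by rintro rfl; simp at h3))) :
    G.IsHamiltonian := by
  intro _
  have hne : l ≠ [] := by rintro rfl; simp at h3
  let p := Walk.ofSupport l hne hch
  have hp : p.IsPath := (Walk.isPath_def _).2 (by rw [Walk.support_ofSupport]; exact hnd)
  have hlen : p.length = l.length - 1 := Walk.length_ofSupport hne hch
  refine ⟨_, Walk.cons hadj p, ?_⟩
  rw [Walk.isHamiltonianCycle_iff_isCycle_and_length_eq, Walk.cons_isCycle_iff]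
  refine ⟨⟨hp, fun he => ?_⟩, by rw [Walk.length_cons, hlen]; omega⟩
  have := hp.length_eq_one_of_mem_edges (Sym2.eq_swap ▸ he)
  omega

/-- Dirac's bound, for graphs with a spanning path. -/
theorem IsKConnected.two_mul_lt_card_of_not_isHamiltonian [Fintype V] [DecidableEq V]
    (hG : G.IsKConnected k) {l : List V} (hl : G.IsLongestPathList l)
    (hcard : l.length = Fintype.card V) (h3 : 3 ≤ l.length) (hH : ¬ G.IsHamiltonian) :
    2 * k < l.length := by
  classical
  cases l with
  | nil => simp at h3
  | cons c l =>
    by_contra! hk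
    have hI := hG.le_card_rotations hl
    have hJ : k ≤ #{i : Fin l.length |
        G.Adj ((c :: l).getLast (by simp)) ((c :: l)[(i : ℕ)]'(by simp))} := by
      refine (hG.le_card_of_neighbors (v := (c :: l).getLast (by simp))
        (N := Finset.image (fun i : Fin l.length => (c :: l)[(i : ℕ)]'(by simp))
          {i | G.Adj ((c :: l).getLast (by simp)) ((c :: l)[(i : ℕ)]'(by simp))}) ?_).trans
        card_image_le
      intro x hx
      have hxl : x ∈ c :: l := by
        have : (c :: l).toFinset = univ :=
          (card_eq_iff_eq_univ _).1 (by rw [List.toFinset_card_of_nodup hl.2.1, hcard])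
        exact List.mem_toFinset.1 (this ▸ mem_univ x)
      obtain ⟨i, hi, rfl⟩ := List.getElem_of_mem hxl
      have hil : i ≠ l.length := by
        rintro rfl
        rw [List.getLast_eq_getElem] at hx
        exact G.irrefl hx
      rw [List.length_cons] at hi
      exact Finset.mem_image.2 ⟨⟨i, by omega⟩, by simpa using hx, rfl⟩
    -- Two sets of at least `k` indices cannot be disjoint among `l.length < 2 * k` positions.
    obtain ⟨i, hi⟩ : ∃ i : Fin l.length, G.Adj c l[i] ∧
        G.Adj ((c :: l).getLast (by simp)) ((c :: l)[(i : ℕ)]'(by simp)) := by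
      by_contra! h
      have hdisj : Disjoint ({i : Fin l.length | G.Adj c l[i]} : Finset (Fin l.length))
          ({i : Fin l.length |
            G.Adj ((c :: l).getLast (by simp)) ((c :: l)[(i : ℕ)]'(by simp))} : Finset _) :=
        disjoint_filter.2 fun i _ => h i
      have := card_le_univ (({i : Fin l.length | G.Adj c l[i]} : Finset (Fin l.length)) ∪
          ({i : Fin l.length |
            G.Adj ((c :: l).getLast (by simp)) ((c :: l)[(i : ℕ)]'(by simp))} : Finset _))
      rw [card_union_of_disjoint hdisj, Fintype.card_fin] at this
      rw [List.length_cons] at hk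
      omega
    -- Crossing chords: go from `c` to position `i`, jump to the last vertex, return to position `i
    -- + 1` and close up at `c`.
    have hperm : ((c :: l).take (i + 1) ++ ((c :: l).drop (i + 1)).reverse).Perm (c :: l) :=
      ((List.reverse_perm _).append_left _).trans (by rw [List.take_append_drop])
    have hdrop : l.drop i ≠ [] := by simp
    refine hH (isHamiltonian_of_list
      (l := (c :: l).take (i + 1) ++ ((c :: l).drop (i + 1)).reverse) ?_
      (hperm.nodup_iff.2 hl.2.1) (hperm.length_eq.trans hcard) (hperm.length_eq ▸ h3) ?_)
    · rw [List.isChain_append]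
      refine ⟨hl.1.take _, isChain_adj_reverse (hl.1.drop _), ?_⟩
      intro x hx y hy
      rw [← List.take_concat_get' _ _ (by simp)] at hx
      simp only [List.getLast?_append, List.getLast?_singleton, Option.some_or, Option.mem_def,
        Option.some.injEq] at hx
      rw [List.head?_reverse, List.getLast?_drop, if_neg (by simp),
        List.getLast?_eq_getLast_of_ne_nil (by simp)] at hy
      simp only [Option.mem_def, Option.some.injEq] at hy
      rw [← hx, ← hy]
      exact hi.2.symm
    · have h1 : ((c :: l).drop (i + 1)).reverse = (l.drop (i + 1)).reverse ++ [l[i]] := by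
        rw [List.drop_succ_cons, ← List.cons_getElem_drop_succ (h := i.2)]
        simp
      simp only [h1, List.take_succ_cons, List.cons_append, List.head_cons]
      rw [List.getLast_cons (by simp), List.getLast_append_of_ne_nil (by simp) (by simp)]
      simpa using hi.1.symm

end LongestPaths

end SimpleGraph

theorem mainTheorem1 {V : Type*} [Fintype V] [DecidableEq V] (G : SimpleGraph V) (n k : ℕ)
    (hn : Fintype.card V = n) (hG : G.IsKConnected k)
    (hH : ¬ G.IsHamiltonian ∨ 4 * k + 1 ≤ 3 * n)
    {a b c d : V} (P : G.Walk a b) (Q : G.Walk c d)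
    (hP : P.IsLongestPath) (hQ : Q.IsLongestPath) :
    ((P.support.toFinset ∩ Q.support.toFinset).card : ℝ) ≥ (8 * (k : ℝ) - (n : ℝ) + 2) / 5 := by
  have hl := hP.isLongestPathList_support
  have hm := hQ.isLongestPathList_support
  have hlen : P.support.length = Q.support.length :=
    le_antisymm (hm.2.2 _ hl.1 hl.2.1) (hl.2.2 _ hm.1 hm.2.1)
  have hcl := List.toFinset_card_of_nodup hl.2.1
  have hcm := List.toFinset_card_of_nodup hm.2.1
  have hunion := Finset.card_union_add_card_inter P.support.toFinset Q.support.toFinset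
  have hle := Finset.card_le_univ (P.support.toFinset ∪ Q.support.toFinset)
  have hkn := hG.1
  rw [Nat.card_eq_fintype_card] at hkn
  suffices h : 8 * k + 2 ≤ 5 * (P.support.toFinset ∩ Q.support.toFinset).card + n by
    have h' : (8 * k + 2 : ℝ) ≤ 5 * (P.support.toFinset ∩ Q.support.toFinset).card + n := by
      exact_mod_cast h
    rw [ge_iff_le, div_le_iff₀ (by norm_num)]
    linarith
  by_cases hspan : ∃ v, v ∉ Q.support
  · obtain ⟨v, hv⟩ := hspan
    have hd := (hG.length_bounds hm hv (N := Finset.univ) (by simp)).1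
    by_cases hk : (P.support.toFinset ∩ Q.support.toFinset).card < k
    · have := hG.length_bound_of_inter hl hm P.support_ne_nil hk
      omega
    · omega
  · push Not at hspan
    have hQn : Q.support.length = Fintype.card V := by
      rw [← hcm, ← Finset.card_univ]
      congr 1
      ext x
      simp [hspan x]
    by_cases h : 4 * k + 1 ≤ 3 * n
    · omega
    -- Here `3 * n < 4 * k + 1` and `k < n` force `n > 3`, while Dirac's bound `2 * k < n` is
    -- contradictory.
    · have := hG.two_mul_lt_card_of_not_isHamiltonian hm hQn (by omega) (hH.resolve_right h)
      omega
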